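/- **Setting.** Let $(\Delta,\mathcal D,\mathbb P)$ be a probability space, $\mathcal X\subseteq\mathbb R^{n_x}$ and $\mathcal Y\subseteq\mathbb R^{n_y}$ convex sets, $c\in\mathbb R^{n_x}$, $\tilde c\in\mathbb R^{n_y}$, and $g:\mathcal X\times\Delta\to\mathbb R$, $\tilde g:\mathcal Y\times\mathcal X\times\Delta\to\mathbb R$ functions such that $g(\cdot,\delta)$ and $\tilde g(\cdot,x,\delta)$ are convex for all $\delta\in\Delta$, $x\in\mathcal X$. For $m\ge 1$ and a multisample $(\delta_1,\dots,\delta_m)\in\Delta^m$ consider the scenario programs $$\mathcal P[\{\delta_i\}_{i=1}^m]:\ \min_{x\in\mathcal X}c^Tx\ \text{ s.t. } g(x,\delta_i)\le 0,\ i=1,\dots,m,$$ $$\widetilde{\mathcal P}[x,\{\delta_i\}_{i=1}^m]:\ \min_{y\in\mathcal Y}\tilde c^Ty\ \text{ s.t. } \tilde g(y,x,\delta_i)\le 0,\ i=1,\dots,m\qquad(x\in\mathcal X).$$ Assume that for every $m\ge1$, every multisample and every $x\in\mathcal X$, both programs have a feasible region with non-empty interior and a unique minimizer; denote the minimizers by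 $x_m=x_m(\delta_1,\dots,\delta_m)$ and $y_m[x]=y_m[x](\delta_1,\dots,\delta_m)$. Assume also that for every $m\ge 1$ the set of $(\delta_1,\dots,\delta_m,\delta)\in\Delta^m\times\Delta$ with $g(x_m,\delta)>0$ or $\tilde g(y_m[x_m],x_m,\delta)>0$ is measurable. The $i$-th constraint of a scenario program is a *support constraint* if its removal strictly improves the objective value, i.e. if the program without sample $i$ has a feasible point of strictly smaller cost than every feasible point of the full program. **Theorem.** For every $m\in\mathbb N$ and every multisample, $\mathcal P[\{\delta_i\}_{i=1}^m]$ has at most $n_x$ support constraints and, for every $x\in\mathcal X$, $\widetilde{\mathcal P}[x,\{\delta_i\}_{i=1}^m]$ has at most $n_y$ support constraints. Moreover, let $d_1,d_2\in\mathbb N$ be such that for every $k\in\mathbb N$, with $\mathbb P^k$-probability one, $\mathcal P[\{\delta_i\}_{i=1}^k]$ has at most $d_1$ support constraints, and, with $\mathbb P^k$-probability one, $\widetilde{\mathcal P}[x,\{\delta_i\}_{i=1}^k]$ has at most $d_2$ support constraints for all $x\in\mathcal X$ simultaneously (so $d_1=n_x$, $d_2=n_y$ are always admissible). Then, with $d=d_1+d_2$,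 for every $m\ge d$ and every $\epsilon\in(0,1)$, $$\mathbb P^m\Big\{(\delta_1,\dots,\delta_m)\in\Delta^m:\ \mathbb P\big(\delta\in\Delta:\ g(x_m,\delta)>0\ \text{or}\ \tilde g(y_m[x_m],x_m,\delta)>0\big)>\epsilon\Big\}\le\binom md(1-\epsilon)^{m-d}.$$ -/

import Mathlib

open MeasureTheory

/-- Feasible set of the scenario program with decision set `X`, constraint function `g` and
sample `ω` (indexed by `ι`): the points `x ∈ X` with `g x (ω i) ≤ 0` for every sample `ω i`.
Only the values of `g` on `X` matter. -/
def scenarioFeasible {n : ℕ} {Δ ι : Type*} (X : Set (EuclideanSpace ℝ (Fin n)))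
    (g : EuclideanSpace ℝ (Fin n) → Δ → ℝ) (ω : ι → Δ) : Set (EuclideanSpace ℝ (Fin n)) :=
  {x | x ∈ X ∧ ∀ i, g x (ω i) ≤ 0}

/-- `x` solves the scenario program: minimize `⟨c, x⟩` over the feasible set. -/
def IsScenarioMinimizer {n : ℕ} {Δ ι : Type*} (X : Set (EuclideanSpace ℝ (Fin n)))
    (c : EuclideanSpace ℝ (Fin n)) (g : EuclideanSpace ℝ (Fin n) → Δ → ℝ) (ω : ι → Δ)
    (x : EuclideanSpace ℝ (Fin n)) : Prop :=
  x ∈ scenarioFeasible X g ω ∧ IsMinOn (fun z => inner ℝ c z) (scenarioFeasible X g ω) x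

/-- The convex scenario set-up: `X` is convex, every `g (·) δ` is convex on `X`, and for every
(non-empty, finite) multisample the feasible set has non-empty interior and the minimizer exists
and is unique. -/
structure ScenarioSetup {n : ℕ} {Δ : Type*} (X : Set (EuclideanSpace ℝ (Fin n)))
    (c : EuclideanSpace ℝ (Fin n)) (g : EuclideanSpace ℝ (Fin n) → Δ → ℝ) : Prop where
  convex_set : Convex ℝ X
  convex_constraint : ∀ δ, ConvexOn ℝ X (fun x => g x δ)
  interior_nonempty : ∀ m, 1 ≤ m → ∀ ω : Fin m → Δ, (interior (scenarioFeasible X g ω)).Nonempty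
  existsUnique_minimizer : ∀ m, 1 ≤ m → ∀ ω : Fin m → Δ, ∃! x, IsScenarioMinimizer X c g ω x

/-- The cascade set-up: the first program, and the second program for every value `x ∈ X` of its
parameter, are convex scenario programs. -/
structure CascadeSetup {n p : ℕ} {Δ : Type*} (X : Set (EuclideanSpace ℝ (Fin n)))
    (c : EuclideanSpace ℝ (Fin n)) (g : EuclideanSpace ℝ (Fin n) → Δ → ℝ)
    (Y : Set (EuclideanSpace ℝ (Fin p))) (c' : EuclideanSpace ℝ (Fin p))
    (g' : EuclideanSpace ℝ (Fin p) → EuclideanSpace ℝ (Fin n) → Δ → ℝ) : Prop where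
  first : ScenarioSetup X c g
  second : ∀ x ∈ X, ScenarioSetup Y c' (fun y δ => g' y x δ)

/-- The `i`-th sampled constraint is a support constraint: its removal improves the objective
value, i.e. the program without sample `i` has a feasible point of cost strictly smaller than
that of every feasible point of the full program. -/
def IsSupportConstraint {n : ℕ} {Δ ι : Type*} (X : Set (EuclideanSpace ℝ (Fin n)))
    (c : EuclideanSpace ℝ (Fin n)) (g : EuclideanSpace ℝ (Fin n) → Δ → ℝ) (ω : ι → Δ)
    (i : ι) : Prop :=
  ∃ x ∈ scenarioFeasible X g (fun j : {j : ι // j ≠ i} => ω j),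
    ∀ z ∈ scenarioFeasible X g ω, inner ℝ c x < inner ℝ c z

/-- The number of support constraints of the scenario program on an `m`-multisample. -/
noncomputable def supportNumber {n m : ℕ} {Δ : Type*} (X : Set (EuclideanSpace ℝ (Fin n)))
    (c : EuclideanSpace ℝ (Fin n)) (g : EuclideanSpace ℝ (Fin n) → Δ → ℝ) (ω : Fin m → Δ) : ℕ :=
  Set.ncard {i | IsSupportConstraint X c g ω i}

/-- The scenarios `δ` at which the pair `(x, y)` violates a constraint of the cascade. -/
def cascadeViolation {n p : ℕ} {Δ : Type*} (g : EuclideanSpace ℝ (Fin n) → Δ → ℝ)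
    (g' : EuclideanSpace ℝ (Fin p) → EuclideanSpace ℝ (Fin n) → Δ → ℝ)
    (x : EuclideanSpace ℝ (Fin n)) (y : EuclideanSpace ℝ (Fin p)) : Set Δ :=
  {δ | 0 < g x δ ∨ 0 < g' y x δ}

/-! ### Finite families of sampled constraints -/

section Deterministic

variable {n : ℕ} {Δ ι κ : Type*} {X : Set (EuclideanSpace ℝ (Fin n))}
  {c : EuclideanSpace ℝ (Fin n)} {g : EuclideanSpace ℝ (Fin n) → Δ → ℝ}

/-! The bounds by the dimensions come from Helly's theorem (`ScenarioSetup.supportNumber_le`). The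
probabilistic bound is a compression argument. Dropping a non-support constraint keeps the
minimizer, so almost surely some `d` samples already determine both minimizers
(`exists_cascade_compression`). The second program is compressed with its parameter frozen at the
first minimizer, hence the bound uniform in `x`.

The other `m - d` samples are then fresh relative to those `d`, and none of them violates the
constraints at the compressed solution. For a fixed `d`-subset, a violation probability above `ε`
thus has probability at most `(1 - ε) ^ (m - d)` (`measure_lt_and_forall_notMem_le`). A union bound
over the `d`-subsets gives the binomial factor.

For `d = 0` one would compress to the empty sample, where no unique minimizer is assumed. There a
fresh sample leaves the minimizers unchanged, so it is almost surely not violated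
(`CascadeSetup.ae_violation_eq_zero`). -/

lemma mem_scenarioFeasible_coe {ω : ι → Δ} {T : Finset ι} {x : EuclideanSpace ℝ (Fin n)} :
    x ∈ scenarioFeasible X g (fun i : T => ω i) ↔ x ∈ X ∧ ∀ i ∈ T, g x (ω i) ≤ 0 := by
  simp [scenarioFeasible]

lemma scenarioFeasible_comp {ω : ι → Δ} {T : Finset ι} {e : κ → ι} (he : Set.range e = T) :
    scenarioFeasible X g (ω ∘ e) = scenarioFeasible X g (fun i : T => ω i) := by
  ext x
  rw [mem_scenarioFeasible_coe]
  simp [scenarioFeasible, ← Finset.mem_coe, ← he]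

lemma isScenarioMinimizer_comp_iff {ω : ι → Δ} {T : Finset ι} {e : κ → ι}
    (he : Set.range e = T) {x : EuclideanSpace ℝ (Fin n)} :
    IsScenarioMinimizer X c g (ω ∘ e) x ↔ IsScenarioMinimizer X c g (fun i : T => ω i) x := by
  simp [IsScenarioMinimizer, scenarioFeasible_comp he]

lemma isScenarioMinimizer_univ_iff [Fintype ι] {ω : ι → Δ} {x : EuclideanSpace ℝ (Fin n)} :
    IsScenarioMinimizer X c g (fun i : (Finset.univ : Finset ι) => ω i) x ↔
      IsScenarioMinimizer X c g ω x :=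
  (isScenarioMinimizer_comp_iff (e := id) (by simp)).symm

/-- The minimizer of a program that also solves a relaxation solves every program in between. -/
lemma IsScenarioMinimizer.of_subset_of_subset {ω : ι → Δ} {S U T : Finset ι} (hSU : S ⊆ U)
    (hUT : U ⊆ T) {x : EuclideanSpace ℝ (Fin n)}
    (hS : IsScenarioMinimizer X c g (fun i : S => ω i) x)
    (hT : IsScenarioMinimizer X c g (fun i : T => ω i) x) :
    IsScenarioMinimizer X c g (fun i : U => ω i) x := by
  have hx := mem_scenarioFeasible_coe.1 hT.1
  refine ⟨mem_scenarioFeasible_coe.2 ⟨hx.1, fun i hi => hx.2 i (hUT hi)⟩, fun z hz => hS.2 ?_⟩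
  have hz := mem_scenarioFeasible_coe.1 hz
  exact mem_scenarioFeasible_coe.2 ⟨hz.1, fun i hi => hz.2 i (hSU hi)⟩

lemma Finset.range_coe_comp_equivFin_symm (T : Finset ι) :
    Set.range ((Function.Embedding.subtype (· ∈ T)) ∘ T.equivFin.symm) = T := by
  rw [EquivLike.range_comp]
  ext
  simp

/-- Removing a constraint that is not a support constraint keeps the minimizer. -/
lemma IsScenarioMinimizer.erase [DecidableEq ι] {ω : ι → Δ} {T : Finset ι} {i : ι}
    {x : EuclideanSpace ℝ (Fin n)}
    (hx : IsScenarioMinimizer X c g (fun j : T => ω j) x)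
    (hi : ∀ y ∈ scenarioFeasible X g (fun j : T.erase i => ω j),
      ∃ z ∈ scenarioFeasible X g (fun j : T => ω j), inner ℝ c z ≤ inner ℝ c y) :
    IsScenarioMinimizer X c g (fun j : T.erase i => ω j) x := by
  have hx' := mem_scenarioFeasible_coe.1 hx.1
  refine ⟨mem_scenarioFeasible_coe.2
    ⟨hx'.1, fun j hj => hx'.2 j (Finset.mem_of_mem_erase hj)⟩, fun y hy => ?_⟩
  obtain ⟨z, hz, hzy⟩ := hi y hy
  exact (hx.2 hz).trans hzy

/-- If there are more constraints than support constraints, then one of them is not a support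
constraint; if there are no support constraints at all, it can be chosen different from `a`. -/
lemma exists_not_support [DecidableEq ι] {ω : ι → Δ} {d : ℕ}
    (hd : ∀ (k : ℕ) (e : Fin k ↪ ι), supportNumber X c g (ω ∘ e) ≤ d)
    {T : Finset ι} (hdT : d < T.card) (hT : 1 < T.card) (a : ι) :
    ∃ i ∈ T, (d = 0 → i ≠ a) ∧
      ∀ y ∈ scenarioFeasible X g (fun j : T.erase i => ω j),
        ∃ z ∈ scenarioFeasible X g (fun j : T => ω j), inner ℝ c z ≤ inner ℝ c y := by
  let e : Fin T.card ↪ ι := T.equivFin.symm.toEmbedding.trans (Function.Embedding.subtype (· ∈ T))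
  have hrange : Set.range e = T := T.range_coe_comp_equivFin_symm
  have hcard := hd _ e
  obtain ⟨k, hka, hk⟩ : ∃ k, (d = 0 → e k ≠ a) ∧ ¬ IsSupportConstraint X c g (ω ∘ e) k := by
    rcases Nat.eq_zero_or_pos d with rfl | hpos
    · obtain ⟨i, hi, hia⟩ := Finset.exists_mem_ne hT a
      obtain ⟨k, rfl⟩ : i ∈ Set.range e := hrange ▸ hi
      have : {i | IsSupportConstraint X c g (ω ∘ e) i} = ∅ := by
        rw [← Set.ncard_eq_zero]
        exact Nat.le_zero.1 hcard
      exact ⟨k, fun _ => hia, fun hk => (this ▸ hk : k ∈ (∅ : Set _))⟩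
    · by_contra! hall
      have : {i | IsSupportConstraint X c g (ω ∘ e) i} = Set.univ :=
        Set.eq_univ_of_forall fun k => hall k fun h0 => absurd h0 hpos.ne'
      rw [supportNumber, this, Set.ncard_univ, Nat.card_fin] at hcard
      exact absurd hcard (not_le.2 hdT)
  refine ⟨e k, Finset.mem_coe.1 (hrange.subset (Set.mem_range_self k)), hka, ?_⟩
  have herase : Set.range (fun j : {j // j ≠ k} => e j) = (T.erase (e k) : Finset ι) := by
    ext i
    rw [Finset.coe_erase, ← hrange]
    constructor
    · rintro ⟨j, rfl⟩
      exact ⟨⟨j, rfl⟩, fun h => j.2 (e.injective h)⟩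
    · rintro ⟨⟨j, rfl⟩, hj⟩
      exact ⟨⟨j, fun h => hj (h ▸ rfl)⟩, rfl⟩
  unfold IsSupportConstraint at hk
  push Not at hk
  have h1 := scenarioFeasible_comp (X := X) (g := g) (ω := ω) hrange
  have h2 := scenarioFeasible_comp (X := X) (g := g) (ω := ω) herase
  rw [h1] at hk
  change ∀ y ∈ scenarioFeasible X g (ω ∘ fun j : {j // j ≠ k} => e j), _ at hk
  rwa [h2] at hk

/-- The minimizer is determined by at most `max d 1` of the constraints, and by any single one of
them if there are no support constraints. -/
lemma IsScenarioMinimizer.exists_compression [DecidableEq ι] {ω : ι → Δ} {d : ℕ}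
    (hd : ∀ (k : ℕ) (e : Fin k ↪ ι), supportNumber X c g (ω ∘ e) ≤ d)
    {T : Finset ι} {a : ι} (ha : a ∈ T) {x : EuclideanSpace ℝ (Fin n)}
    (hx : IsScenarioMinimizer X c g (fun j : T => ω j) x) :
    ∃ S ⊆ T, S.Nonempty ∧ S.card ≤ max d 1 ∧ (d = 0 → a ∈ S) ∧
      IsScenarioMinimizer X c g (fun j : S => ω j) x := by
  induction T using Finset.strongInduction generalizing a with
  | H T ih =>
    -- The descent stops at one constraint, since uniqueness is only assumed for nonempty samples.
    by_cases hT : T.card ≤ max d 1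
    · exact ⟨T, subset_rfl, ⟨a, ha⟩, hT, fun _ => ha, hx⟩
    rw [not_le, max_lt_iff] at hT
    obtain ⟨i, hi, hia, hsup⟩ := exists_not_support hd hT.1 hT.2 a
    have hne : (T.erase i).Nonempty := by
      rw [← Finset.card_pos, Finset.card_erase_of_mem hi]
      omega
    obtain ⟨b, hb, hba⟩ : ∃ b ∈ T.erase i, d = 0 → b = a := by
      by_cases h0 : d = 0
      · exact ⟨a, Finset.mem_erase.2 ⟨(hia h0).symm, ha⟩, fun _ => rfl⟩
      · exact ⟨hne.choose, hne.choose_spec, fun h => absurd h h0⟩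
    obtain ⟨S, hS, hSne, hcard, hbS, hmin⟩ :=
      ih _ (Finset.erase_ssubset hi) hb (hx.erase hsup)
    exact ⟨S, hS.trans (Finset.erase_subset _ _), hSne, hcard, fun h0 => hba h0 ▸ hbS h0, hmin⟩

/-- By Helly's theorem, the number of support constraints is at most the dimension. -/
lemma ScenarioSetup.supportNumber_le (h : ScenarioSetup X c g) {m : ℕ} (ω : Fin m → Δ) :
    supportNumber X c g ω ≤ n := by
  classical
  by_contra! hlt
  rw [supportNumber, Set.ncard_eq_toFinset_card'] at hlt
  obtain ⟨I, hI, hIcard⟩ := Finset.exists_subset_card_eq (Nat.succ_le_of_lt hlt)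
  have hsupp : ∀ i ∈ I, IsSupportConstraint X c g ω i := fun i hi => by simpa using hI hi
  have hm : 1 ≤ m := by
    have := I.card_le_univ
    simp only [Fintype.card_fin] at this
    omega
  obtain ⟨xs, hxs, -⟩ := h.existsUnique_minimizer m hm ω
  -- Helly family of `n + 2` convex sets: the points cheaper than the optimum and, for each of `n +
  -- 1` support constraints, the points satisfying it together with all constraints outside `I`. A
  -- common point would be feasible and beat the optimum.
  let F : Option (Fin m) → Set (EuclideanSpace ℝ (Fin n)) := fun o =>
    o.elim {x | inner ℝ c x < inner ℝ c xs}
      (fun i => {x | x ∈ X ∧ ∀ j, (j = i ∨ j ∉ I) → g x (ω j) ≤ 0})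
  have hconv : ∀ o ∈ Finset.insertNone I, Convex ℝ (F o) := by
    rintro (_ | i) -
    · exact convex_halfSpace_lt (innerSL ℝ c).toLinearMap.isLinear _
    · have : F (some i) = X ∩ ⋂ j, ⋂ _ : j = i ∨ j ∉ I, {x | x ∈ X ∧ g x (ω j) ≤ 0} := by
        ext x
        simp only [F, Option.elim, Set.mem_ofPred_eq, Set.mem_inter_iff, Set.mem_iInter]
        exact ⟨fun hx => ⟨hx.1, fun j hj => ⟨hx.1, hx.2 j hj⟩⟩,
          fun hx => ⟨hx.1, fun j hj => (hx.2 j hj).2⟩⟩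
      rw [this]
      exact h.convex_set.inter
        (convex_iInter₂ fun j _ => (h.convex_constraint (ω j)).convex_le 0)
  have hinter : (⋂ o ∈ Finset.insertNone I, F o).Nonempty := by
    refine Convex.helly_theorem (𝕜 := ℝ) (by simp; omega) hconv fun J hJ hJcard => ?_
    obtain ⟨a, ha, haJ⟩ : ∃ a ∈ Finset.insertNone I, a ∉ J := by
      refine Finset.exists_mem_notMem_of_card_lt_card ?_
      rw [hJcard, Finset.card_insertNone, hIcard, finrank_euclideanSpace_fin]
      omega
    -- If the half-space is omitted, the minimizer is a common point; if constraint `i` is omitted,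
    -- the cheaper point gained by removing `i` is one.
    rcases a with _ | i
    · refine ⟨xs, Set.mem_iInter₂.2 ?_⟩
      rintro (_ | j) hj
      · exact absurd hj haJ
      · exact ⟨hxs.1.1, fun k _ => hxs.1.2 k⟩
    · have hi : i ∈ I := by simpa using ha
      obtain ⟨z, hz, hlt⟩ := hsupp i hi
      refine ⟨z, Set.mem_iInter₂.2 ?_⟩
      rintro (_ | j) hj
      · exact hlt xs hxs.1
      · refine ⟨hz.1, fun k hk => hz.2 ⟨k, ?_⟩⟩
        rintro rfl
        rcases hk with rfl | hk
        · exact haJ hj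
        · exact hk hi
  obtain ⟨z, hz⟩ := hinter
  rw [Set.mem_iInter₂] at hz
  have hlt : inner ℝ c z < inner ℝ c xs := hz none (by simp)
  obtain ⟨i, hi⟩ : I.Nonempty := by
    rw [← Finset.card_pos]
    omega
  refine absurd hlt (not_lt.2 (hxs.2 ⟨(hz (some i) (by simpa using hi)).1, fun j => ?_⟩))
  by_cases hj : j ∈ I
  · exact (hz (some j) (by simpa using hj)).2 j (Or.inl rfl)
  · exact (hz (some i) (by simpa using hi)).2 j (Or.inr hj)

end Deterministic

/-- Compression for the cascade: the minimizers of both programs are determined by `d₁ + d₂` of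
the samples. -/
lemma exists_cascade_compression {n p d₁ d₂ : ℕ} {Δ ι : Type*} [Fintype ι] [Nonempty ι]
    {X : Set (EuclideanSpace ℝ (Fin n))} {c : EuclideanSpace ℝ (Fin n)}
    {g : EuclideanSpace ℝ (Fin n) → Δ → ℝ} {Y : Set (EuclideanSpace ℝ (Fin p))}
    {c' : EuclideanSpace ℝ (Fin p)}
    {g' : EuclideanSpace ℝ (Fin p) → EuclideanSpace ℝ (Fin n) → Δ → ℝ}
    {ω : ι → Δ}
    (h₁ : ∀ (k : ℕ) (e : Fin k ↪ ι), supportNumber X c g (ω ∘ e) ≤ d₁)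
    (h₂ : ∀ (k : ℕ) (e : Fin k ↪ ι), ∀ x ∈ X,
      supportNumber Y c' (fun y δ => g' y x δ) (ω ∘ e) ≤ d₂)
    (hd : 1 ≤ d₁ + d₂) (hcard : d₁ + d₂ ≤ Fintype.card ι)
    {x : EuclideanSpace ℝ (Fin n)} {y : EuclideanSpace ℝ (Fin p)}
    (hx : IsScenarioMinimizer X c g ω x)
    (hy : IsScenarioMinimizer Y c' (fun y δ => g' y x δ) ω y) :
    ∃ U : Finset ι, U.card = d₁ + d₂ ∧ IsScenarioMinimizer X c g (fun i : U => ω i) x ∧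
      IsScenarioMinimizer Y c' (fun y δ => g' y x δ) (fun i : U => ω i) y := by
  classical
  obtain ⟨a₀⟩ := ‹Nonempty ι›
  have hxX : x ∈ X := hx.1.1
  rw [← isScenarioMinimizer_univ_iff] at hx hy
  have c₁ (a : ι) := hx.exists_compression h₁ (Finset.mem_univ a)
  have c₂ (a : ι) := hy.exists_compression (fun k e => h₂ k e x hxX) (Finset.mem_univ a)
  obtain ⟨S₁, S₂, hS₁, hS₂, hcardS⟩ : ∃ S₁ S₂ : Finset ι,
      IsScenarioMinimizer X c g (fun i : S₁ => ω i) x ∧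
      IsScenarioMinimizer Y c' (fun y δ => g' y x δ) (fun i : S₂ => ω i) y ∧
      (S₁ ∪ S₂).card ≤ d₁ + d₂ := by
    -- A program with bound zero still keeps one sample. Choosing that sample inside the other
    -- program's set keeps the union within `d₁ + d₂`.
    rcases Nat.eq_zero_or_pos d₁ with h0 | hpos
    · obtain ⟨S₂, -, ⟨a, ha⟩, hcard₂, -, hS₂⟩ := c₂ a₀
      obtain ⟨S₁, -, -, hcard₁, haS, hS₁⟩ := c₁ a
      refine ⟨S₁, S₂, hS₁, hS₂, ?_⟩
      have hsub : S₁ ⊆ S₂ := fun b hb => by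
        rwa [Finset.card_le_one.1 (by simpa [h0] using hcard₁) b hb a (haS h0)]
      rw [Finset.union_eq_right.2 hsub]
      omega
    · obtain ⟨S₁, -, ⟨a, ha⟩, hcard₁, -, hS₁⟩ := c₁ a₀
      obtain ⟨S₂, -, -, hcard₂, haS, hS₂⟩ := c₂ a
      refine ⟨S₁, S₂, hS₁, hS₂, ?_⟩
      rcases Nat.eq_zero_or_pos d₂ with h0 | hpos₂
      · have hsub : S₂ ⊆ S₁ := fun b hb => by
          rwa [Finset.card_le_one.1 (by simpa [h0] using hcard₂) b hb a (haS h0)]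
        rw [Finset.union_eq_left.2 hsub]
        omega
      · have := Finset.card_union_le S₁ S₂
        omega
  obtain ⟨U, hSU, -, hU⟩ := Finset.exists_subsuperset_card_eq (Finset.subset_univ (S₁ ∪ S₂))
    hcardS (by simpa using hcard)
  exact ⟨U, hU,
    hS₁.of_subset_of_subset (Finset.union_subset_left hSU) (Finset.subset_univ U) hx,
    hS₂.of_subset_of_subset (Finset.union_subset_right hSU) (Finset.subset_univ U) hy⟩

/-- Without support constraints, every single sample determines both minimizers. -/
lemma isScenarioMinimizer_singleton_of_cascade {n p : ℕ} {Δ ι : Type*}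
    {X : Set (EuclideanSpace ℝ (Fin n))} {c : EuclideanSpace ℝ (Fin n)}
    {g : EuclideanSpace ℝ (Fin n) → Δ → ℝ} {Y : Set (EuclideanSpace ℝ (Fin p))}
    {c' : EuclideanSpace ℝ (Fin p)}
    {g' : EuclideanSpace ℝ (Fin p) → EuclideanSpace ℝ (Fin n) → Δ → ℝ}
    {ω : ι → Δ}
    (h₁ : ∀ (k : ℕ) (e : Fin k ↪ ι), supportNumber X c g (ω ∘ e) ≤ 0)
    (h₂ : ∀ (k : ℕ) (e : Fin k ↪ ι), ∀ x ∈ X,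
      supportNumber Y c' (fun y δ => g' y x δ) (ω ∘ e) ≤ 0)
    {T : Finset ι} {a : ι} (ha : a ∈ T)
    {x : EuclideanSpace ℝ (Fin n)} {y : EuclideanSpace ℝ (Fin p)}
    (hx : IsScenarioMinimizer X c g (fun i : T => ω i) x)
    (hy : IsScenarioMinimizer Y c' (fun y δ => g' y x δ) (fun i : T => ω i) y) :
    IsScenarioMinimizer X c g (fun i : ({a} : Finset ι) => ω i) x ∧
      IsScenarioMinimizer Y c' (fun y δ => g' y x δ) (fun i : ({a} : Finset ι) => ω i) y := by
  classical
  have hxX : x ∈ X := hx.1.1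
  have key (S : Finset ι) (hS : S.card ≤ max 0 1) (haS : a ∈ S) : S = {a} :=
    Finset.eq_singleton_iff_unique_mem.2
      ⟨haS, fun b hb => Finset.card_le_one.1 (by simpa using hS) b hb a haS⟩
  obtain ⟨S₁, -, -, hcard₁, haS₁, hS₁⟩ := hx.exists_compression h₁ ha
  obtain ⟨S₂, -, -, hcard₂, haS₂, hS₂⟩ :=
    hy.exists_compression (fun k e => h₂ k e x hxX) ha
  obtain rfl := key S₁ hcard₁ (haS₁ rfl)
  obtain rfl := key S₂ hcard₂ (haS₂ rfl)
  exact ⟨hS₁, hS₂⟩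

/-! ### Multisamples -/

section Multisample

variable {Δ ι κ α β : Type*} [MeasurableSpace Δ] [Fintype ι] [Fintype κ] [Fintype α] [Fintype β]

lemma measurePreserving_comp_embedding (μ : Measure Δ) [IsProbabilityMeasure μ] (e : κ ↪ ι) :
    MeasurePreserving (fun ω : ι → Δ => ω ∘ e) (Measure.pi fun _ => μ)
      (Measure.pi fun _ => μ) := by
  have hm : Measurable fun ω : ι → Δ => ω ∘ e :=
    measurable_pi_iff.2 fun i => measurable_pi_apply (e i)
  refine ⟨hm, (Measure.pi_eq fun s hs => ?_).symm⟩
  rw [Measure.map_apply hm (MeasurableSet.univ_pi hs)]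
  have hpre : (fun ω : ι → Δ => ω ∘ e) ⁻¹' Set.univ.pi s =
      Set.univ.pi (Function.extend e s fun _ => Set.univ) := by
    ext ω
    simp only [Set.mem_preimage, Set.mem_univ_pi, Function.comp_apply]
    refine ⟨fun h j => ?_, fun h i => ?_⟩
    · by_cases hj : ∃ i, e i = j
      · obtain ⟨i, rfl⟩ := hj
        rw [e.injective.extend_apply]
        exact h i
      · rw [Function.extend_apply' _ _ _ hj]
        trivial
    · simpa [e.injective.extend_apply] using h (e i)
  rw [hpre, Measure.pi_pi]
  refine (Fintype.prod_of_injective e e.injective _ _ (fun j hj => ?_) fun i => ?_).symm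
  · rw [Function.extend_apply' _ _ _ (by simpa using hj), measure_univ]
  · rw [e.injective.extend_apply]

/-- Subsamples are again i.i.d. and there are only countably many of them, so the exceptional null
sets can be united. -/
lemma ae_forall_embedding {μ : Measure Δ} [IsProbabilityMeasure μ]
    {P : (k : ℕ) → (Fin k → Δ) → Prop}
    (h : ∀ k, ∀ᵐ ω ∂(Measure.pi fun _ : Fin k => μ), P k ω) :
    ∀ᵐ ω ∂(Measure.pi fun _ : ι => μ), ∀ (k : ℕ) (e : Fin k ↪ ι), P k (ω ∘ e) :=
  ae_all_iff.2 fun k => ae_all_iff.2 fun e =>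
    (measurePreserving_comp_embedding μ e).quasiMeasurePreserving.ae (h k)

lemma measurePreserving_comp_sum (μ : Measure Δ) [IsProbabilityMeasure μ] (σ : α ⊕ β ≃ ι) :
    MeasurePreserving (fun ω : ι → Δ => (fun i => ω (σ (.inl i)), fun j => ω (σ (.inr j))))
      (Measure.pi fun _ => μ) ((Measure.pi fun _ : α => μ).prod (Measure.pi fun _ : β => μ)) :=
  (measurePreserving_sumPiEquivProdPi fun _ : α ⊕ β => μ).comp
    (measurePreserving_comp_embedding μ σ.toEmbedding)

/-- The probability that `β`-many fresh samples avoid a set of measure larger than `ε`, which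
depends on the samples indexed by `α`. -/
lemma measure_lt_and_forall_notMem_le (μ : Measure Δ) [IsProbabilityMeasure μ]
    {V : (α → Δ) → Set Δ} (hV : MeasurableSet {q : (α → Δ) × Δ | q.2 ∈ V q.1}) {ε : ℝ} :
    ((Measure.pi fun _ : α => μ).prod (Measure.pi fun _ : β => μ))
      {q | ε < μ.real (V q.1) ∧ ∀ j, q.2 j ∉ V q.1} ≤
        ENNReal.ofReal (1 - ε) ^ Fintype.card β := by
  have hVm (u : α → Δ) : MeasurableSet (V u) := hV.preimage measurable_prodMk_left
  have hVmeas : Measurable fun u => μ.real (V u) :=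
    (measurable_measure_prodMk_left hV).ennreal_toReal
  have hmeas : MeasurableSet
      {q : (α → Δ) × (β → Δ) | ε < μ.real (V q.1) ∧ ∀ j, q.2 j ∉ V q.1} := by
    rw [Set.ofPred_and, Set.ofPred_forall]
    refine (measurableSet_lt measurable_const (hVmeas.comp measurable_fst)).inter
      (MeasurableSet.iInter fun j => MeasurableSet.compl ?_)
    exact hV.preimage
      (measurable_fst.prodMk ((measurable_pi_apply j).comp measurable_snd))
  rw [Measure.prod_apply hmeas]
  calc _ ≤ ∫⁻ _ : α → Δ, ENNReal.ofReal (1 - ε) ^ Fintype.card β ∂(Measure.pi fun _ => μ) := by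
        refine lintegral_mono fun u => ?_
        by_cases hu : ε < μ.real (V u)
        · have : Prod.mk u ⁻¹' {q : (α → Δ) × (β → Δ) | ε < μ.real (V q.1) ∧ ∀ j, q.2 j ∉ V q.1}
              = Set.univ.pi fun _ => (V u)ᶜ := by
            ext v
            simp [hu]
          rw [this, Measure.pi_pi, Finset.prod_const, Finset.card_univ]
          gcongr
          rw [← ofReal_measureReal, probReal_compl_eq_one_sub (hVm u)]
          exact ENNReal.ofReal_le_ofReal (by linarith)
        · simp [hu]
    _ = _ := by simp

end Multisample

/-! ### Violation probability of the cascade -/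

section Violation

variable {nx ny : ℕ} {Δ : Type*}
  {X : Set (EuclideanSpace ℝ (Fin nx))} {c : EuclideanSpace ℝ (Fin nx)}
  {g : EuclideanSpace ℝ (Fin nx) → Δ → ℝ}
  {Y : Set (EuclideanSpace ℝ (Fin ny))} {c' : EuclideanSpace ℝ (Fin ny)}
  {g' : EuclideanSpace ℝ (Fin ny) → EuclideanSpace ℝ (Fin nx) → Δ → ℝ}
  {xs : (m : ℕ) → (Fin m → Δ) → EuclideanSpace ℝ (Fin nx)}
  {ys : (m : ℕ) → EuclideanSpace ℝ (Fin nx) → (Fin m → Δ) → EuclideanSpace ℝ (Fin ny)}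

lemma CascadeSetup.minimizers_eq (hsetup : CascadeSetup X c g Y c' g')
    (hxs : ∀ m, 1 ≤ m → ∀ ω : Fin m → Δ, IsScenarioMinimizer X c g ω (xs m ω))
    (hys : ∀ m, 1 ≤ m → ∀ x ∈ X, ∀ ω : Fin m → Δ,
      IsScenarioMinimizer Y c' (fun y δ => g' y x δ) ω (ys m x ω))
    {m : ℕ} (hm : 1 ≤ m) {ω : Fin m → Δ}
    {x : EuclideanSpace ℝ (Fin nx)} {y : EuclideanSpace ℝ (Fin ny)}
    (hx : IsScenarioMinimizer X c g ω x)
    (hy : IsScenarioMinimizer Y c' (fun y δ => g' y x δ) ω y) :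
    xs m ω = x ∧ ys m (xs m ω) ω = y := by
  obtain rfl := (hsetup.first.existsUnique_minimizer m hm ω).unique (hxs m hm ω) hx
  exact ⟨rfl, ((hsetup.second _ hx.1.1).existsUnique_minimizer m hm ω).unique
    (hys m hm _ hx.1.1 ω) hy⟩

variable [MeasurableSpace Δ] {μ : Measure Δ} [IsProbabilityMeasure μ]

/-- Without support constraints the cascade is almost surely never violated. -/
lemma CascadeSetup.ae_violation_eq_zero (hsetup : CascadeSetup X c g Y c' g')
    (hxs : ∀ m, 1 ≤ m → ∀ ω : Fin m → Δ, IsScenarioMinimizer X c g ω (xs m ω))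
    (hys : ∀ m, 1 ≤ m → ∀ x ∈ X, ∀ ω : Fin m → Δ,
      IsScenarioMinimizer Y c' (fun y δ => g' y x δ) ω (ys m x ω))
    (h₁ : ∀ k : ℕ, ∀ᵐ ω ∂(Measure.pi fun _ : Fin k => μ), supportNumber X c g ω ≤ 0)
    (h₂ : ∀ k : ℕ, ∀ᵐ ω ∂(Measure.pi fun _ : Fin k => μ),
      ∀ x ∈ X, supportNumber Y c' (fun y δ => g' y x δ) ω ≤ 0)
    {m : ℕ} (hm : 1 ≤ m) :
    ∀ᵐ ω ∂(Measure.pi fun _ : Fin m => μ),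
      μ (cascadeViolation g g' (xs m ω) (ys m (xs m ω) ω)) = 0 := by
  -- One fresh sample is appended to the `m` given ones.
  let σ : Fin m ⊕ Fin 1 ≃ Fin (m + 1) := finSumFinEquiv
  let V (ω : Fin m → Δ) : Set Δ := cascadeViolation g g' (xs m ω) (ys m (xs m ω) ω)
  have key : ∀ᵐ ω ∂(Measure.pi fun _ : Fin m ⊕ Fin 1 => μ),
      ω (.inr 0) ∉ V fun i => ω (.inl i) := by
    filter_upwards [ae_forall_embedding (ι := Fin m ⊕ Fin 1) h₁,
      ae_forall_embedding (ι := Fin m ⊕ Fin 1) h₂] with ω hω₁ hω₂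
    have hσ : Set.range σ.symm = (Finset.univ : Finset (Fin m ⊕ Fin 1)) := by simp
    let x := xs (m + 1) (ω ∘ σ.symm)
    let y := ys (m + 1) x (ω ∘ σ.symm)
    have hx : IsScenarioMinimizer X c g (ω ∘ σ.symm) x := hxs _ (by omega) _
    have hy : IsScenarioMinimizer Y c' (fun y δ => g' y x δ) (ω ∘ σ.symm) y :=
      hys _ (by omega) _ hx.1.1 _
    have hlast : ω (.inr 0) ∉ cascadeViolation g g' x y := by
      have e₁ := hx.1.2 (σ (.inr 0))
      have e₂ := hy.1.2 (σ (.inr 0))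
      simp only [Function.comp_apply, Equiv.symm_apply_apply] at e₁ e₂
      simp [cascadeViolation, e₁, e₂]
    rw [isScenarioMinimizer_comp_iff hσ] at hx hy
    -- An old sample alone determines the minimizers, so the `m`-sample and the `(m + 1)`-sample
    -- programs share them.
    have hsing := isScenarioMinimizer_singleton_of_cascade hω₁ hω₂
      (Finset.mem_univ (.inl ⟨0, hm⟩)) hx hy
    let T : Finset (Fin m ⊕ Fin 1) := Finset.univ.map Function.Embedding.inl
    have hT : Set.range (Sum.inl : Fin m → Fin m ⊕ Fin 1) = T := by
      ext
      simp [T]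
    have hsub : {.inl ⟨0, hm⟩} ⊆ T := by simp [T]
    have hx' := hsing.1.of_subset_of_subset hsub (Finset.subset_univ T) hx
    have hy' := hsing.2.of_subset_of_subset hsub (Finset.subset_univ T) hy
    rw [← isScenarioMinimizer_comp_iff hT] at hx' hy'
    obtain ⟨ex, ey⟩ := hsetup.minimizers_eq hxs hys hm hx' hy'
    change _ ∉ cascadeViolation g g' (xs m (ω ∘ Sum.inl)) (ys m (xs m (ω ∘ Sum.inl)) (ω ∘ Sum.inl))
    rwa [ey, ex]
  have hpres := (measurePreserving_sumPiEquivProdPi fun _ : Fin m ⊕ Fin 1 => μ).symm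
  have key' := Measure.ae_ae_of_ae_prod (hpres.quasiMeasurePreserving.ae key)
  filter_upwards [key'] with u hu
  have hconst := (measurePreserving_funUnique μ (Fin 1)).symm
  exact measure_eq_zero_iff_ae_notMem.2 (hconst.quasiMeasurePreserving.ae hu)

/-- The sampling bound for the cascade when `d₁ + d₂` is positive. -/
lemma CascadeSetup.measure_violation_le (hsetup : CascadeSetup X c g Y c' g')
    (hxs : ∀ m, 1 ≤ m → ∀ ω : Fin m → Δ, IsScenarioMinimizer X c g ω (xs m ω))
    (hys : ∀ m, 1 ≤ m → ∀ x ∈ X, ∀ ω : Fin m → Δ,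
      IsScenarioMinimizer Y c' (fun y δ => g' y x δ) ω (ys m x ω))
    (hmeas : ∀ m, 1 ≤ m → MeasurableSet {q : (Fin m → Δ) × Δ |
      q.2 ∈ cascadeViolation g g' (xs m q.1) (ys m (xs m q.1) q.1)})
    {d₁ d₂ : ℕ}
    (h₁ : ∀ k : ℕ, ∀ᵐ ω ∂(Measure.pi fun _ : Fin k => μ), supportNumber X c g ω ≤ d₁)
    (h₂ : ∀ k : ℕ, ∀ᵐ ω ∂(Measure.pi fun _ : Fin k => μ),
      ∀ x ∈ X, supportNumber Y c' (fun y δ => g' y x δ) ω ≤ d₂)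
    (hd : 1 ≤ d₁ + d₂) {m : ℕ} (hm : d₁ + d₂ ≤ m) (ε : ℝ) :
    (Measure.pi fun _ : Fin m => μ)
        {ω | ε < μ.real (cascadeViolation g g' (xs m ω) (ys m (xs m ω) ω))}
      ≤ m.choose (d₁ + d₂) * ENNReal.ofReal (1 - ε) ^ (m - (d₁ + d₂)) := by
  classical
  let V (k : ℕ) (ω : Fin k → Δ) : Set Δ := cascadeViolation g g' (xs k ω) (ys k (xs k ω) ω)
  let P := (Finset.univ : Finset (Fin m)).powersetCard (d₁ + d₂)
  have hPcard {U : Finset (Fin m)} (hU : U ∈ P) : U.card = d₁ + d₂ :=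
    (Finset.mem_powersetCard.1 hU).2
  have hcompl (U : P) : (U : Finset (Fin m))ᶜ.card = m - (d₁ + d₂) := by
    rw [Finset.card_compl, hPcard U.2, Fintype.card_fin]
  let σ (U : P) : Fin (d₁ + d₂) ⊕ Fin (m - (d₁ + d₂)) ≃ Fin m :=
    finSumEquivOfFinset (hPcard U.2) (hcompl U)
  let B : Set ((Fin (d₁ + d₂) → Δ) × (Fin (m - (d₁ + d₂)) → Δ)) :=
    {q | ε < μ.real (V _ q.1) ∧ ∀ j, q.2 j ∉ V _ q.1}
  let φ (U : P) (ω : Fin m → Δ) : (Fin (d₁ + d₂) → Δ) × (Fin (m - (d₁ + d₂)) → Δ) :=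
    (fun i => ω (σ U (.inl i)), fun j => ω (σ U (.inr j)))
  have hcover : {ω | ε < μ.real (V m ω)} ≤ᵐ[Measure.pi fun _ : Fin m => μ]
      ⋃ U : P, φ U ⁻¹' B := by
    filter_upwards [ae_forall_embedding (ι := Fin m) h₁, ae_forall_embedding (ι := Fin m) h₂]
      with ω hω₁ hω₂ hω
    have hm' : 1 ≤ m := hd.trans hm
    have hx := hxs m hm' ω
    have hy := hys m hm' _ hx.1.1 ω
    have : Nonempty (Fin m) := ⟨⟨0, hm'⟩⟩
    obtain ⟨U, hU, hxU, hyU⟩ :=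
      exists_cascade_compression hω₁ hω₂ hd (by simpa using hm) hx hy
    have hUP : U ∈ P := Finset.mem_powersetCard.2 ⟨Finset.subset_univ U, hU⟩
    have hrange : Set.range (fun i => σ ⟨U, hUP⟩ (.inl i)) = U := by
      simp [σ]
    rw [← isScenarioMinimizer_comp_iff hrange] at hxU hyU
    obtain ⟨ex, ey⟩ := hsetup.minimizers_eq hxs hys hd hxU hyU
    have hV : V _ (φ ⟨U, hUP⟩ ω).1 = V m ω := by
      change cascadeViolation g g' (xs _ (ω ∘ fun i => σ ⟨U, hUP⟩ (.inl i)))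
        (ys _ (xs _ (ω ∘ fun i => σ ⟨U, hUP⟩ (.inl i))) (ω ∘ fun i => σ ⟨U, hUP⟩ (.inl i))) = _
      rw [ey, ex]
    refine Set.mem_iUnion.2 ⟨⟨U, hUP⟩, ?_, fun j => ?_⟩
    · rw [hV]
      exact hω
    · rw [hV]
      -- The compressed solution is the full one, hence feasible for the left-out samples too.
      rintro (hpos | hpos)
      · exact absurd hpos (not_lt.2 (hx.1.2 _))
      · exact absurd hpos (not_lt.2 (hy.1.2 _))
  calc _ ≤ (Measure.pi fun _ : Fin m => μ) (⋃ U : P, φ U ⁻¹' B) := measure_mono_ae hcover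
    _ ≤ ∑ U : P, (Measure.pi fun _ : Fin m => μ) (φ U ⁻¹' B) := measure_iUnion_fintype_le _ _
    _ ≤ ∑ _U : P, ENNReal.ofReal (1 - ε) ^ (m - (d₁ + d₂)) := by
        refine Finset.sum_le_sum fun U _ => ?_
        refine ((measurePreserving_comp_sum μ (σ U)).measure_preimage_le B).trans ?_
        simpa using measure_lt_and_forall_notMem_le (β := Fin (m - (d₁ + d₂))) μ (hmeas _ hd)
    _ = _ := by simp [P, Finset.card_powersetCard]

end Violation

theorem mainTheorem11 {nx ny : ℕ} {Δ : Type*} [MeasurableSpace Δ]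
    (μ : Measure Δ) [IsProbabilityMeasure μ]
    (X : Set (EuclideanSpace ℝ (Fin nx))) (c : EuclideanSpace ℝ (Fin nx))
    (g : EuclideanSpace ℝ (Fin nx) → Δ → ℝ)
    (Y : Set (EuclideanSpace ℝ (Fin ny))) (c' : EuclideanSpace ℝ (Fin ny))
    (g' : EuclideanSpace ℝ (Fin ny) → EuclideanSpace ℝ (Fin nx) → Δ → ℝ)
    (hsetup : CascadeSetup X c g Y c' g')
    -- the minimizers `x_m` of the first and `y_m[x]` of the second program
    (xs : (m : ℕ) → (Fin m → Δ) → EuclideanSpace ℝ (Fin nx))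
    (hxs : ∀ m, 1 ≤ m → ∀ ω : Fin m → Δ, IsScenarioMinimizer X c g ω (xs m ω))
    (ys : (m : ℕ) → EuclideanSpace ℝ (Fin nx) → (Fin m → Δ) → EuclideanSpace ℝ (Fin ny))
    (hys : ∀ m, 1 ≤ m → ∀ x ∈ X, ∀ ω : Fin m → Δ,
      IsScenarioMinimizer Y c' (fun y δ => g' y x δ) ω (ys m x ω))
    -- measurability of the violation event, jointly in the multisample and the new scenario
    (hmeas : ∀ m, 1 ≤ m → MeasurableSet {q : (Fin m → Δ) × Δ |
      q.2 ∈ cascadeViolation g g' (xs m q.1) (ys m (xs m q.1) q.1)}) :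
    -- the numbers of support constraints are bounded by the dimensions
    (∀ (m : ℕ) (ω : Fin m → Δ), supportNumber X c g ω ≤ nx ∧
      ∀ x ∈ X, supportNumber Y c' (fun y δ => g' y x δ) ω ≤ ny) ∧
    -- the violation bound, for all almost sure bounds on the numbers of support constraints
    ∀ d₁ d₂ : ℕ,
      (∀ k : ℕ, ∀ᵐ ω ∂(Measure.pi fun _ : Fin k => μ), supportNumber X c g ω ≤ d₁) →
      (∀ k : ℕ, ∀ᵐ ω ∂(Measure.pi fun _ : Fin k => μ),
        ∀ x ∈ X, supportNumber Y c' (fun y δ => g' y x δ) ω ≤ d₂) →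
      ∀ m : ℕ, d₁ + d₂ ≤ m → ∀ ε : ℝ, 0 < ε → ε < 1 →
        (Measure.pi fun _ : Fin m => μ).real
            {ω | ε < μ.real (cascadeViolation g g' (xs m ω) (ys m (xs m ω) ω))}
          ≤ (m.choose (d₁ + d₂) : ℝ) * (1 - ε) ^ (m - (d₁ + d₂)) := by
  refine ⟨fun m ω => ⟨hsetup.first.supportNumber_le ω,
    fun x hx => (hsetup.second x hx).supportNumber_le ω⟩, fun d₁ d₂ h₁ h₂ m hm ε hε hε1 => ?_⟩
  have hbound : 0 ≤ (m.choose (d₁ + d₂) : ℝ) * (1 - ε) ^ (m - (d₁ + d₂)) :=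
    mul_nonneg (Nat.cast_nonneg _) (pow_nonneg (by linarith) _)
  rcases Nat.eq_zero_or_pos (d₁ + d₂) with hd | hd
  · obtain ⟨rfl, rfl⟩ : d₁ = 0 ∧ d₂ = 0 := by omega
    -- For `m = 0` the bound is `1`, whatever the values of `xs` and `ys`.
    rcases Nat.eq_zero_or_pos m with rfl | hm0
    · simp
    · refine le_of_eq_of_le ?_ hbound
      rw [measureReal_eq_zero_iff, measure_eq_zero_iff_ae_notMem]
      filter_upwards [hsetup.ae_violation_eq_zero hxs hys h₁ h₂ hm0] with ω hω hlt
      refine absurd (show ε < μ.real _ from hlt) (not_lt.2 ?_)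
      rw [measureReal_def, hω, ENNReal.toReal_zero]
      exact hε.le
  · refine ENNReal.toReal_le_of_le_ofReal hbound
      ((hsetup.measure_violation_le hxs hys hmeas h₁ h₂ hd hm ε).trans_eq ?_)
    rw [ENNReal.ofReal_mul (Nat.cast_nonneg _), ENNReal.ofReal_natCast,
      ENNReal.ofReal_pow (by linarith)]
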